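/- Let $K>2$. Let $(\varepsilon_n)_{n\ge 0}$, $(N_n)_{n\ge 0}$, $(U_n)_{n\ge 0}$ be mutually independent random variables such that for every $n$, $\mathbb P(\varepsilon_n=1)=\mathbb P(\varepsilon_n=-1)=\tfrac12$, $N_n$ is uniform on $\{0,\dots,n\}$, and $\mathbb P(U_n=0)=\mathbb P(U_n=1)=\tfrac12$. For $x>0$ let $(X_n)_{n\ge 0}$ be the (non-Markovian) process with $X_0=x$ and, as long as $X_n>0$, $$X_{n+1}=X_n+1+K\varepsilon_n\sqrt{R_n},\qquad R_n=U_n\frac{X_n^2}{X_n+X_{N_n}}+(1-U_n)\frac{X_nX_{N_n}}{X_n+X_{N_n}},$$ with the convention that a value $\le 0$ is replaced by $0$ and that the process stays at $0$ from then on. Write $\mathbb P_x$ for the law of the process started at $x$, and $\tau_A=\inf\{n\ge 0: X_n\le A\}$ (with $\inf\emptyset=\infty$). Then for all real $\alpha,\beta$ with $\alpha<1-\frac{4}{K^2}<\beta$ there exists $A>0$ such that for every $x>A$ there exist constants $C_\alpha>0$ and $C_\beta>0$ such that for all integers $n\ge 1$, $$\frac{C_\beta}{n^{\beta}}\le \mathbb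 P_x(\tau_A>n)\le \frac{C_\alpha}{n^{\alpha}}.$$ -/

import Mathlib

open MeasureTheory ProbabilityTheory

namespace GrowthExample

/-- The random factor `u * y² / (y + z) + (1 - u) * y z / (y + z)`: with `y` the present state,
`z` the state at a randomly chosen time of the past and `u ∈ {0, 1}` a random bit. -/
noncomputable def mix (u y z : ℝ) : ℝ :=
  u * (y ^ 2 / (y + z)) + (1 - u) * (y * z / (y + z))

/-- The trajectory started at `x` and driven by signs `e`, past times `N n ∈ {0, …, n}` and
bits `u`: as long as the state is positive,
`X (n + 1) = X n + 1 + K * e n * √(R n)` with `R n = mix (u n) (X n) (X (N n))`;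
a nonpositive value is replaced by `0`, and `0` is absorbing. -/
noncomputable def path (K x : ℝ) (e : ℕ → ℝ) (N : (n : ℕ) → Fin (n + 1)) (u : ℕ → ℝ) : ℕ → ℝ
  | 0 => x
  | n + 1 =>
    if path K x e N u n ≤ 0 then 0
    else max 0 (path K x e N u n + 1 +
      K * e n * √(mix (u n) (path K x e N u n) (path K x e N u (N n))))
  termination_by n => n
  decreasing_by all_goals omega

variable {Ω : Type*}

/-- The stochastic process `X` started at `x`. -/
noncomputable def process (K x : ℝ) (ε : ℕ → Ω → ℝ) (N : (n : ℕ) → Ω → Fin (n + 1))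
    (U : ℕ → Ω → ℝ) (n : ℕ) (ω : Ω) : ℝ :=
  path K x (fun k => ε k ω) (fun k => N k ω) (fun k => U k ω) n

/-- The driving random variables: `ε n` is uniform on `{-1, 1}`, `N n` is uniform on
`{0, …, n}`, `U n` is uniform on `{0, 1}`, and all these random variables are mutually
independent (the variables within each of the three sequences are independent, and the three
sequences are independent of one another). -/
structure IsNoise [MeasurableSpace Ω] (μ : Measure Ω) (ε : ℕ → Ω → ℝ)
    (N : (n : ℕ) → Ω → Fin (n + 1)) (U : ℕ → Ω → ℝ) : Prop where
  measurable_sign : ∀ n, Measurable (ε n)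
  measurable_time : ∀ n, Measurable (N n)
  measurable_bit : ∀ n, Measurable (U n)
  sign_neg : ∀ n, μ.real {ω | ε n ω = -1} = 1 / 2
  sign_pos : ∀ n, μ.real {ω | ε n ω = 1} = 1 / 2
  time_unif : ∀ n, ∀ i : Fin (n + 1), μ.real {ω | N n ω = i} = 1 / ((n : ℝ) + 1)
  bit_zero : ∀ n, μ.real {ω | U n ω = 0} = 1 / 2
  bit_one : ∀ n, μ.real {ω | U n ω = 1} = 1 / 2
  indep : iIndepFun
    (Sum.elim ε (Sum.elim (fun n ω => (((N n ω : Fin (n + 1)) : ℕ) : ℝ)) U)) μ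

/-- The first time `τ_A = inf {n | X n ≤ A}`, with value `⊤` if there is no such time. -/
noncomputable def tau (X : ℕ → Ω → ℝ) (A : ℝ) : Ω → WithTop ℕ :=
  hittingAfter X (Set.Iic A) 0

end GrowthExample

namespace GrowthExample

open Filter Topology

/-! The two values of `R_n` selected by the bit add up to `X_n`. Averaging over sign and bit
therefore gives the fluctuation variance `K² X_n / 2`, whatever the past state. Hence, far from the
origin, the mean increment of `y ^ γ` is `γ (1 - (1 - γ) K² / 4) y ^ (γ - 1)` up to a small multiple
of `y ^ (γ - 1)`. For `0 < γ < 1` its sign changes exactly at `γ = 1 - 4 / K²`.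

Although the process is not Markovian, one-step inequalities uniform in the past state `z > 0`
suffice. Take `v m y` with `m` the time left. If the one-step mean of `v m` is at most `v (m + 1)`,
iteration from time `n` back to time `0` bounds the survival probability by `v n x`; the reversed
inequality gives a lower bound. `exists_supersolution` builds such a function of order `m ^ (-γ)`
for `γ` below the critical exponent, `exists_subsolution` one for `γ` above it.
`IsNoise.setIntegral_process_succ` turns the four-point mean into a conditional expectation, and
`IsNoise.measureReal_survival_le` and `IsNoise.le_measureReal_survival` carry out the iteration. -/

/-! ### One-step estimates, uniform in the past state -/

/-- Second order expansion of `t ↦ t ^ γ` at `1`. -/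
lemma exists_rpow_expansion (γ : ℝ) {ε : ℝ} (hε : 0 < ε) :
    ∃ δ, 0 < δ ∧ δ < 1 ∧ ∀ h : ℝ, |h| ≤ δ →
      |(1 + h) ^ γ - (1 + γ * h + γ * (γ - 1) / 2 * h ^ 2)| ≤ ε * h ^ 2 := by
  have key : (fun t : ℝ => (t ^ γ - γ * (t - 1) - γ * (γ - 1) / 2 * (t - 1) ^ 2) -
      ((1 : ℝ) ^ γ - γ * (1 - 1) - γ * (γ - 1) / 2 * (1 - 1) ^ 2)) =o[𝓝[Set.Ioi 0] 1]
      fun t => (t - 1) ^ (1 + 1) := by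
    refine (convex_Ioi (0 : ℝ)).isLittleO_pow_succ_real (f := fun t : ℝ =>
      t ^ γ - γ * (t - 1) - γ * (γ - 1) / 2 * (t - 1) ^ 2)
      (f' := fun t => γ * (t ^ (γ - 1) - (1 : ℝ) ^ (γ - 1) - (t - 1) * (γ - 1)))
      (by simp) (fun t ht => ?_) ?_
    · have ht0 : t ≠ 0 := ne_of_gt ht
      have h1 := Real.hasDerivAt_rpow_const (x := t) (p := γ) (Or.inl ht0)
      have h2 : HasDerivAt (fun t : ℝ => t - 1) 1 t := (hasDerivAt_id t).sub_const 1
      have h3 := (h1.sub (h2.const_mul γ)).sub ((h2.pow 2).const_mul (γ * (γ - 1) / 2))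
      have h4 := h3.hasDerivWithinAt (s := Set.Ioi 0)
      refine h4.congr_deriv ?_
      simp only [Real.one_rpow]
      norm_num
      ring
    · have h1 := Real.hasDerivAt_rpow_const (x := 1) (p := γ - 1) (Or.inl one_ne_zero)
      have h2 := (hasDerivAt_iff_isLittleO.1 h1).const_mul_left γ
      refine (h2.mono nhdsWithin_le_nhds).congr (fun t => ?_) (fun t => ?_)
      · simp
      · simp
  rw [Asymptotics.isLittleO_iff] at key
  have h1 := key hε
  rw [(isOpen_Ioi).nhdsWithin_eq (by simp : (1 : ℝ) ∈ Set.Ioi 0), Metric.eventually_nhds_iff] at h1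
  obtain ⟨r, hr, h⟩ := h1
  refine ⟨min (r / 2) (1 / 2), by positivity, (min_le_right _ _).trans_lt (by norm_num),
    fun u hu => ?_⟩
  have := @h (1 + u) (by
    simp only [Real.dist_eq, add_sub_cancel_left]
    linarith [hu.trans (min_le_left _ _)])
  simp only [add_sub_cancel_left, Real.norm_eq_abs, Real.one_rpow] at this
  rw [abs_of_nonneg (sq_nonneg u : 0 ≤ u ^ (1 + 1))] at this
  convert this using 2
  ring

/-- One step of the process from the state `y` with past state `z`, sign `a` and bit `b`. -/
noncomputable def growthStep (K y z a b : ℝ) : ℝ :=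
  max 0 (y + 1 + K * a * √(mix b y z))

/-- The mean of `f` over the four equally likely outcomes of one step. -/
noncomputable def stepMean (K : ℝ) (f : ℝ → ℝ) (y z : ℝ) : ℝ :=
  (f (growthStep K y z 1 0) + f (growthStep K y z (-1) 0) +
    f (growthStep K y z 1 1) + f (growthStep K y z (-1) 1)) / 4

/-- Far from the origin, the two possible fluctuations are small relative to the state and
have total variance `K ^ 2 * y`. -/
lemma exists_stepMean_eq {K δ : ℝ} (hK : 0 < K) (hδ : 0 < δ) (hδ1 : δ < 1) :
    ∃ A : ℝ, 1 ≤ A ∧ ∀ y z : ℝ, A < y → 0 < z → ∃ d₁ d₂ : ℝ,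
      0 ≤ d₁ ∧ 0 ≤ d₂ ∧ 1 + d₁ ≤ δ * y ∧ 1 + d₂ ≤ δ * y ∧ d₁ ^ 2 + d₂ ^ 2 = K ^ 2 * y ∧
      ∀ f : ℝ → ℝ, stepMean K f y z =
        (f (y + (1 + d₁)) + f (y + (1 - d₁)) + f (y + (1 + d₂)) + f (y + (1 - d₂))) / 4 := by
  -- Beyond this threshold `1 + K √y ≤ (1 + K) √y ≤ δ y < y`, so the truncation at `0` never acts.
  refine ⟨max 1 (((1 + K) / δ) ^ 2), le_max_left _ _, fun y z hy hz => ?_⟩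
  have hy1 : 1 < y := (le_max_left _ _).trans_lt hy
  have hy0 : 0 < y := by linarith
  have hyz : 0 < y + z := by linarith
  have hbig : ((1 + K) / δ) ^ 2 < y := (le_max_right _ _).trans_lt hy
  have hs : (1 + K) / δ ≤ √y := Real.le_sqrt_of_sq_le hbig.le
  have hs1 : 1 ≤ √y := Real.one_le_sqrt.2 hy1.le
  have hss : √y * √y = y := Real.mul_self_sqrt hy0.le
  have hsmall : 1 + K * √y ≤ δ * y := by
    rw [div_le_iff₀ hδ] at hs
    nlinarith [mul_le_mul_of_nonneg_right hs (Real.sqrt_nonneg y)]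
  have m0 : mix 0 y z = y * z / (y + z) := by simp [mix]
  have m1 : mix 1 y z = y ^ 2 / (y + z) := by simp [mix]
  have m0n : 0 ≤ mix 0 y z := by rw [m0]; positivity
  have m1n : 0 ≤ mix 1 y z := by rw [m1]; positivity
  have msum : mix 0 y z + mix 1 y z = y := by
    rw [m0, m1]; field_simp; ring
  have hb : ∀ b, mix b y z ≤ y → 1 + K * √(mix b y z) ≤ δ * y := fun b hb =>
    le_trans (by gcongr) hsmall
  have hb0 := hb 0 (by linarith)
  have hb1 := hb 1 (by linarith)
  have hδy : δ * y < y := by nlinarith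
  refine ⟨K * √(mix 0 y z), K * √(mix 1 y z), by positivity, by positivity, hb0, hb1, ?_, ?_⟩
  · rw [mul_pow, mul_pow, Real.sq_sqrt m0n, Real.sq_sqrt m1n, ← mul_add, msum]
  · intro f
    have e : ∀ b, 1 + K * √(mix b y z) ≤ δ * y →
        growthStep K y z 1 b = y + (1 + K * √(mix b y z)) ∧
        growthStep K y z (-1) b = y + (1 - K * √(mix b y z)) := by
      intro b h
      have hn : 0 ≤ K * √(mix b y z) := by positivity
      constructor
      · unfold growthStep
        rw [max_eq_right (by linarith)]; ring
      · unfold growthStep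
        rw [max_eq_right (by linarith)]; ring
    rw [stepMean, (e 0 hb0).1, (e 0 hb0).2, (e 1 hb1).1, (e 1 hb1).2]

/-- Far from the origin, all outcomes of a step are positive. -/
lemma exists_stepMean_mono {K : ℝ} (hK : 0 < K) :
    ∃ A : ℝ, 1 ≤ A ∧ ∀ y z : ℝ, A < y → 0 < z → ∀ f g : ℝ → ℝ, (∀ t, 0 < t → f t ≤ g t) →
      stepMean K f y z ≤ stepMean K g y z := by
  obtain ⟨A, hA, hstep⟩ := exists_stepMean_eq hK (by norm_num : (0 : ℝ) < 1 / 2) (by norm_num)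
  refine ⟨A, hA, fun y z hy hz f g hfg => ?_⟩
  obtain ⟨d₁, d₂, h1, h2, hd1, hd2, -, heq⟩ := hstep y z hy hz
  rw [heq, heq]
  linarith [hfg (y + (1 + d₁)) (by linarith), hfg (y + (1 - d₁)) (by linarith),
    hfg (y + (1 + d₂)) (by linarith), hfg (y + (1 - d₂)) (by linarith)]

/-- The mean increment of `y ^ γ` over one step. -/
lemma exists_stepMean_rpow {K : ℝ} (hK : 0 < K) (γ : ℝ) {η : ℝ} (hη : 0 < η) :
    ∃ A : ℝ, 1 ≤ A ∧ ∀ y z : ℝ, A < y → 0 < z →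
      |stepMean K (fun t => t ^ γ) y z - y ^ γ -
        γ * (1 - (1 - γ) * K ^ 2 / 4) * y ^ (γ - 1)| ≤ η * y ^ (γ - 1) := by
  -- The Taylor error averages to about `ε K² / 2 · y ^ (γ - 1)`, which uses half of `η`. The other
  -- half covers the `y ^ (γ - 2)` terms coming from the deterministic `+ 1`.
  set ε : ℝ := η / (K ^ 2 + 1) with hε
  have hε0 : 0 < ε := by positivity
  obtain ⟨δ, hδ, hδ1, hexp⟩ := exists_rpow_expansion γ hε0
  obtain ⟨A, hA, hstep⟩ := exists_stepMean_eq hK hδ hδ1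
  set B : ℝ := |γ * (γ - 1) / 2| + ε with hB
  have hB0 : 0 < B := by positivity
  have hεη : ε * (K ^ 2 + 1) = η := by rw [hε]; field_simp
  clear_value ε B
  refine ⟨max A (2 * B / η), hA.trans (le_max_left _ _), fun y z hy hz => ?_⟩
  have hyA : A < y := (le_max_left _ _).trans_lt hy
  have hyB : 2 * B / η < y := (le_max_right _ _).trans_lt hy
  have hy0 : 0 < y := by linarith
  obtain ⟨d₁, d₂, h1, h2, hd1, hd2, hsum, heq⟩ := hstep y z hyA hz
  rw [heq]
  have hpow : y ^ (γ - 1) = y ^ γ / y := by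
    rw [Real.rpow_sub hy0, Real.rpow_one]
  have hyγ : 0 < y ^ γ := Real.rpow_pos_of_pos hy0 γ
  have hterm : ∀ d, |d| ≤ δ * y →
      |(y + d) ^ γ - y ^ γ * (1 + γ * (d / y) + γ * (γ - 1) / 2 * (d / y) ^ 2)| ≤
        y ^ γ * (ε * (d / y) ^ 2) := by
    intro d hd
    have hdy : |d / y| ≤ δ := by
      rw [abs_div, abs_of_pos hy0, div_le_iff₀ hy0]; exact hd
    have h1' : 0 ≤ 1 + d / y := by linarith [(abs_le.1 hdy).1]
    have : y + d = y * (1 + d / y) := by field_simp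
    rw [this, Real.mul_rpow hy0.le h1', ← mul_sub, abs_mul, abs_of_pos hyγ]
    exact mul_le_mul_of_nonneg_left (hexp _ hdy) hyγ.le
  have t1 := hterm (1 + d₁) (by rw [abs_of_nonneg (by linarith)]; exact hd1)
  have t2 := hterm (1 - d₁) (by rw [abs_le]; constructor <;> linarith)
  have t3 := hterm (1 + d₂) (by rw [abs_of_nonneg (by linarith)]; exact hd2)
  have t4 := hterm (1 - d₂) (by rw [abs_le]; constructor <;> linarith)
  have hsq : ((1 + d₁) / y) ^ 2 + ((1 - d₁) / y) ^ 2 + ((1 + d₂) / y) ^ 2 + ((1 - d₂) / y) ^ 2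
      = (4 + 2 * (K ^ 2 * y)) / y ^ 2 := by
    rw [← hsum]; field_simp; ring
  have hlin : (1 + d₁) / y + (1 - d₁) / y + (1 + d₂) / y + (1 - d₂) / y = 4 / y := by
    field_simp; ring
  set S := ((y + (1 + d₁)) ^ γ + (y + (1 - d₁)) ^ γ + (y + (1 + d₂)) ^ γ +
    (y + (1 - d₂)) ^ γ) / 4 with hS
  have hmain : |S - y ^ γ * (1 + γ / y + γ * (γ - 1) / 2 * ((1 + K ^ 2 * y / 2) / y ^ 2))| ≤
      y ^ γ * (ε * ((1 + K ^ 2 * y / 2) / y ^ 2)) := by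
    have e1 : (1 + K ^ 2 * y / 2) / y ^ 2 = (((1 + d₁) / y) ^ 2 + ((1 - d₁) / y) ^ 2 +
        ((1 + d₂) / y) ^ 2 + ((1 - d₂) / y) ^ 2) / 4 := by
      rw [hsq]; ring
    have e2 : γ / y = γ * (((1 + d₁) / y + (1 - d₁) / y + (1 + d₂) / y + (1 - d₂) / y) / 4) := by
      rw [hlin]; ring
    rw [e1, e2]
    rw [abs_le] at t1 t2 t3 t4 ⊢
    constructor <;> linarith [t1.1, t1.2, t2.1, t2.2, t3.1, t3.2, t4.1, t4.2]
  have hrew : S - y ^ γ - γ * (1 - (1 - γ) * K ^ 2 / 4) * y ^ (γ - 1) =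
      (S - y ^ γ * (1 + γ / y + γ * (γ - 1) / 2 * ((1 + K ^ 2 * y / 2) / y ^ 2))) +
      y ^ γ * (γ * (γ - 1) / 2 / y ^ 2) := by
    rw [hpow]; field_simp; ring
  rw [hrew, hpow]
  refine (abs_add_le _ _).trans ((add_le_add_left hmain _).trans ?_)
  rw [abs_mul, abs_of_pos hyγ, abs_div, abs_of_pos (by positivity : 0 < y ^ 2), ← mul_add]
  have : ε * ((1 + K ^ 2 * y / 2) / y ^ 2) + |γ * (γ - 1) / 2| / y ^ 2 ≤ η / y := by
    have e : ε * ((1 + K ^ 2 * y / 2) / y ^ 2) + |γ * (γ - 1) / 2| / y ^ 2 =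
        (B / y + ε * K ^ 2 / 2) / y := by
      rw [hB]; field_simp; ring
    rw [e]
    refine div_le_div_of_nonneg_right ?_ hy0.le
    have i1 : B / y ≤ η / 2 := by
      rw [div_lt_iff₀ hη] at hyB
      rw [div_le_iff₀ hy0]; linarith
    have i2 : ε * K ^ 2 ≤ η := by linarith
    linarith
  calc _ ≤ y ^ γ * (η / y) := mul_le_mul_of_nonneg_left this hyγ.le
    _ = _ := by ring

/-- The mean of the inverse over one step. -/
lemma exists_stepMean_inv {K : ℝ} (hK : 0 < K) :
    ∃ A : ℝ, 1 ≤ A ∧ ∀ y z : ℝ, A < y → 0 < z →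
      stepMean K (fun t => t⁻¹) y z ≤ y⁻¹ + (2 + K ^ 2) * (y⁻¹) ^ 2 ∧
      stepMean K (fun t => t) y z = y + 1 := by
  obtain ⟨A, hA, hstep⟩ := exists_stepMean_eq hK (by norm_num : (0 : ℝ) < 1 / 2) (by norm_num)
  refine ⟨A, hA, fun y z hy hz => ?_⟩
  have hy0 : 0 < y := by linarith
  obtain ⟨d₁, d₂, h1, h2, hd1, hd2, hsum, heq⟩ := hstep y z hy hz
  rw [heq, heq]
  refine ⟨?_, by ring⟩
  have hterm : ∀ d, |d| ≤ 1 / 2 * y →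
      (y + d)⁻¹ ≤ y⁻¹ - d * (y⁻¹) ^ 2 + 2 * d ^ 2 * (y⁻¹) ^ 3 := by
    intro d hd
    have hd' := (abs_le.1 hd).1
    have hp : 0 < y + d := by linarith
    -- Doubling the quadratic Taylor coefficient makes the remainder nonnegative for `|d| ≤ y / 2`.
    have e : y⁻¹ - d * (y⁻¹) ^ 2 + 2 * d ^ 2 * (y⁻¹) ^ 3 - (y + d)⁻¹ =
        d ^ 2 * (y + 2 * d) / (y ^ 3 * (y + d)) := by
      field_simp; ring
    have : 0 ≤ d ^ 2 * (y + 2 * d) / (y ^ 3 * (y + d)) := by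
      have : 0 ≤ y + 2 * d := by linarith
      positivity
    linarith
  have t1 := hterm (1 + d₁) (by rw [abs_of_nonneg (by linarith)]; exact hd1)
  have t2 := hterm (1 - d₁) (by rw [abs_le]; constructor <;> linarith)
  have t3 := hterm (1 + d₂) (by rw [abs_of_nonneg (by linarith)]; exact hd2)
  have t4 := hterm (1 - d₂) (by rw [abs_le]; constructor <;> linarith)
  have hyi : y⁻¹ ≤ 1 := inv_le_one_of_one_le₀ (by linarith)
  have hq : 0 ≤ (y⁻¹) ^ 2 := by positivity
  have key : 2 * ((1 + d₁) ^ 2 + (1 - d₁) ^ 2 + (1 + d₂) ^ 2 + (1 - d₂) ^ 2) * (y⁻¹) ^ 3 =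
      8 * (y⁻¹) ^ 3 + 4 * K ^ 2 * (y⁻¹) ^ 2 := by
    have : (1 + d₁) ^ 2 + (1 - d₁) ^ 2 + (1 + d₂) ^ 2 + (1 - d₂) ^ 2 = 4 + 2 * (K ^ 2 * y) := by
      rw [← hsum]; ring
    rw [this]; field_simp; ring
  have hc : (y⁻¹) ^ 3 ≤ (y⁻¹) ^ 2 := by
    rw [pow_succ]; nlinarith
  nlinarith

/-! ### Super- and subsolutions in the remaining time -/

/-- A bounded supersolution vanishing on `(-∞, A]`, decaying in time like `m ^ (-γ)`. -/
lemma exists_supersolution {K γ : ℝ} (hK : 0 < K) (hγ0 : 0 < γ) (hγ : γ < 1 - 4 / K ^ 2) :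
    ∃ A₀ : ℝ, 1 ≤ A₀ ∧ ∀ A, A₀ ≤ A → ∀ x, A < x → ∃ (v : ℕ → ℝ → ℝ) (C : ℝ), 0 < C ∧
      (∀ m, Measurable (v m)) ∧ (∀ m y, 0 ≤ v m y) ∧ (∀ m y, v m y ≤ 1) ∧
      (∀ m y z, A < y → 0 < z → stepMean K (v m) y z ≤ v (m + 1) y) ∧
      (∀ y, A < y → v 0 y = 1) ∧ (∀ m : ℕ, 1 ≤ m → v m x ≤ C / (m : ℝ) ^ γ) := by
  have hγ1 : γ < 1 := hγ.trans_le (by linarith [show 0 ≤ 4 / K ^ 2 by positivity])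
  -- The drift coefficient is negative, equal to `-2c`; one `c` pays for the expansion error and the
  -- other remains.
  obtain ⟨c, hc, hdrift⟩ : ∃ c, 0 < c ∧ γ * (1 - (1 - γ) * K ^ 2 / 4) + c = -c := by
    refine ⟨-(γ * (1 - (1 - γ) * K ^ 2 / 4)) / 2, ?_, by ring⟩
    have h1 : 4 / K ^ 2 < 1 - γ := by linarith
    rw [div_lt_iff₀ (by positivity)] at h1
    nlinarith
  obtain ⟨A₁, hA₁, hpow⟩ := exists_stepMean_rpow hK γ hc
  obtain ⟨A₂, hA₂, hmono⟩ := exists_stepMean_mono hK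
  refine ⟨max (max A₁ A₂) c, hA₁.trans ((le_max_left _ _).trans (le_max_left _ _)),
    fun A hA x hx => ?_⟩
  have hAA₁ : A₁ ≤ A := ((le_max_left _ _).trans (le_max_left _ _)).trans hA
  have hAA₂ : A₂ ≤ A := ((le_max_right _ _).trans (le_max_left _ _)).trans hA
  have hAc : c ≤ A := (le_max_right _ _).trans hA
  have hx0 : 0 < x := by linarith
  refine ⟨fun m y => if A < y then min 1 (y ^ γ / (c * (m + 1)) ^ γ) else 0, (x / c) ^ γ,
    by positivity, fun m => ?_, fun m y => ?_, fun m y => ?_, fun m y z hy hz => ?_,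
    fun y hy => ?_, fun m hm => ?_⟩
  · exact Measurable.ite measurableSet_Ioi (by fun_prop) measurable_const
  · dsimp only
    split_ifs with h
    · have : 0 < y := by linarith
      positivity
    · exact le_rfl
  · dsimp only
    split_ifs with h
    · exact min_le_left _ _
    · exact zero_le_one
  · have hy0 : 0 < y := by linarith
    have hyA₂ : A₂ < y := by linarith
    dsimp only
    rw [if_pos hy]
    refine le_min ?_ ?_
    · refine (hmono y z hyA₂ hz _ (fun _ => 1) fun t _ => ?_).trans_eq (by norm_num [stepMean])
      split_ifs
      · exact min_le_left _ _
      · exact zero_le_one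
    -- For large `y` the target is the cap `1`. Otherwise the relative loss `c / y` exceeds `1 / (m
    -- + 2)`, which outweighs the change of the time factor.
    rcases le_or_gt ((c * (m + 2))) y with hlarge | hsmall
    · refine (hmono y z hyA₂ hz _ (fun _ => 1) fun t _ => ?_).trans ?_
      · split_ifs
        · exact min_le_left _ _
        · exact zero_le_one
      · have : 1 ≤ y ^ γ / (c * ((m : ℝ) + 2)) ^ γ := by
          rw [one_le_div (by positivity)]
          exact Real.rpow_le_rpow (by positivity) hlarge hγ0.le
        push_cast
        rw [add_assoc, one_add_one_eq_two]
        simpa [stepMean] using this.trans' (by norm_num)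
    · have h1 : stepMean K (fun t => if A < t then min 1 (t ^ γ / (c * ((m : ℝ) + 1)) ^ γ) else 0)
          y z ≤ stepMean K (fun t => t ^ γ / (c * ((m : ℝ) + 1)) ^ γ) y z := by
        refine hmono y z hyA₂ hz _ _ fun t ht => ?_
        split_ifs
        · exact min_le_right _ _
        · positivity
      have h2 : stepMean K (fun t => t ^ γ / (c * ((m : ℝ) + 1)) ^ γ) y z =
          stepMean K (fun t => t ^ γ) y z / (c * ((m : ℝ) + 1)) ^ γ := by
        simp only [stepMean]; ring
      have h3 := (abs_le.1 (hpow y z (by linarith) hz)).2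
      have h4 : stepMean K (fun t => t ^ γ) y z ≤ y ^ γ - c * y ^ (γ - 1) := by
        have : (γ * (1 - (1 - γ) * K ^ 2 / 4) + c) * y ^ (γ - 1) = -c * y ^ (γ - 1) := by
          rw [hdrift]
        linarith
      have h5 : y ^ (γ - 1) = y ^ γ / y := by rw [Real.rpow_sub hy0, Real.rpow_one]
      have hyγ : 0 < y ^ γ := by positivity
      have hm2 : (0 : ℝ) < (m : ℝ) + 2 := by positivity
      have h6 : 1 - c / y ≤ (((m : ℝ) + 1) / (m + 2)) ^ γ := by
        have ht : ((m : ℝ) + 1) / (m + 2) ≤ 1 := by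
          rw [div_le_one hm2]; linarith
        have := Real.rpow_le_rpow_of_exponent_ge (by positivity) ht hγ1.le
        rw [Real.rpow_one] at this
        refine le_trans ?_ this
        have : 1 / ((m : ℝ) + 2) ≤ c / y := by
          rw [div_le_div_iff₀ hm2 hy0]; linarith
        have e : ((m : ℝ) + 1) / (m + 2) = 1 - 1 / (m + 2) := by field_simp; ring
        linarith
      rw [h2] at h1
      refine h1.trans ?_
      push_cast
      rw [add_assoc, one_add_one_eq_two, div_le_div_iff₀ (by positivity) (by positivity)]
      have h7 : (c * ((m : ℝ) + 1)) ^ γ =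
          (((m : ℝ) + 1) / (m + 2)) ^ γ * (c * ((m : ℝ) + 2)) ^ γ := by
        rw [← Real.mul_rpow (by positivity) (by positivity)]
        congr 1; field_simp
      rw [h7, ← mul_assoc]
      refine mul_le_mul_of_nonneg_right (h4.trans ?_) (by positivity)
      calc y ^ γ - c * y ^ (γ - 1) = y ^ γ * (1 - c / y) := by rw [h5]; ring
        _ ≤ _ := mul_le_mul_of_nonneg_left h6 hyγ.le
  · dsimp only
    rw [if_pos hy, min_eq_left]
    have : 0 < y := by linarith
    rw [one_le_div (by positivity)]
    refine Real.rpow_le_rpow (by positivity) ?_ hγ0.le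
    push_cast
    linarith
  · dsimp only
    rw [if_pos hx, Real.div_rpow hx0.le hc.le, div_div]
    refine (min_le_right _ _).trans ?_
    have hm0 : (0 : ℝ) < m := by exact_mod_cast hm
    rw [← Real.mul_rpow hc.le hm0.le]
    gcongr
    linarith

/-- A linear term beats a concave power: Bernoulli's inequality at the scale `R` with `R ^ (γ - 1) =
M` gives `B = R ^ γ`. This caps the power part of the subsolution. -/
lemma exists_rpow_sub_mul_le {γ M : ℝ} (hγ0 : 0 < γ) (hγ1 : γ < 1) (hM : 0 < M) :
    ∃ B : ℝ, 0 < B ∧ ∀ r : ℝ, 0 ≤ r → r ^ γ - M * r ≤ B := by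
  set R : ℝ := M ^ (1 / (γ - 1)) with hR
  have hR0 : 0 < R := by positivity
  have hRM : R ^ (γ - 1) = M := by
    rw [hR, ← Real.rpow_mul hM.le, one_div_mul_cancel (by linarith), Real.rpow_one]
  refine ⟨R ^ γ, by positivity, fun r hr => ?_⟩
  have h1 : (r / R) ^ γ ≤ 1 + r / R := by
    have := rpow_one_add_le_one_add_mul_self (s := r / R - 1) (p := γ)
      (by linarith [div_nonneg hr hR0.le]) hγ0.le hγ1.le
    rw [add_sub_cancel] at this
    nlinarith [div_nonneg hr hR0.le]
  rw [Real.div_rpow hr hR0.le, div_le_iff₀ (by positivity)] at h1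
  rw [Real.rpow_sub hR0, Real.rpow_one] at hRM
  have : (1 + r / R) * R ^ γ = R ^ γ + R ^ γ / R * r := by ring
  rw [this, hRM] at h1
  linarith

set_option maxHeartbeats 1000000 in
/-- A bounded subsolution vanishing on `(-∞, A]`, decaying in time not faster than
`m ^ (-γ)`. -/
lemma exists_subsolution {K γ : ℝ} (hK : 0 < K) (hγ0 : 0 < γ) (hγ1 : γ < 1)
    (hγ : 1 - 4 / K ^ 2 < γ) :
    ∃ A₀ : ℝ, 1 ≤ A₀ ∧ ∀ A, A₀ ≤ A → ∀ x, A < x → ∃ (v : ℕ → ℝ → ℝ) (H q : ℝ), 0 < H ∧ 0 < q ∧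
      (∀ m, Measurable (v m)) ∧ (∀ m y, 0 ≤ v m y) ∧ (∀ m y, v m y ≤ H) ∧
      (∀ m y, y ≤ A → v m y = 0) ∧
      (∀ m y z, A < y → 0 < z → v (m + 1) y ≤ stepMean K (v m) y z) ∧
      (∀ m : ℕ, 1 ≤ m → q / (m : ℝ) ^ γ ≤ v m x) := by
  obtain ⟨c, hc, hdrift⟩ : ∃ c, 0 < c ∧ γ * (1 - (1 - γ) * K ^ 2 / 4) - c = c := by
    refine ⟨γ * (1 - (1 - γ) * K ^ 2 / 4) / 2, ?_, by ring⟩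
    have h1 : 1 - γ < 4 / K ^ 2 := by linarith
    rw [lt_div_iff₀ (by positivity)] at h1
    have : 0 < 1 - (1 - γ) * K ^ 2 / 4 := by linarith
    positivity
  obtain ⟨A₁, hA₁, hpow⟩ := exists_stepMean_rpow hK γ hc
  obtain ⟨A₂, hA₂, hmono⟩ := exists_stepMean_mono hK
  obtain ⟨A₃, hA₃, hinv⟩ := exists_stepMean_inv hK
  set b : ℝ := 2 + K ^ 2 with hb
  have hb0 : 0 < b := by positivity
  -- `M` is tuned so that at `y / (T + 1) = 2b`, the worst case of `hp_step`, the gain from the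
  -- drift still pays for the penalty `M y / T`.
  obtain ⟨M, hM, hcM⟩ : ∃ M, 0 < M ∧ c * (2 * b) ^ (γ - 1) = 2 * M * (2 * b + 1) := by
    refine ⟨c * (2 * b) ^ (γ - 1) / (2 * (2 * b + 1)), by positivity, ?_⟩
    field_simp
  obtain ⟨B, hB, hBr⟩ := exists_rpow_sub_mul_le hγ0 hγ1 hM
  clear_value b
  refine ⟨max (max A₁ A₂) A₃, hA₁.trans ((le_max_left _ _).trans (le_max_left _ _)),
    fun A hA x hx => ?_⟩
  have hAA₁ : A₁ ≤ A := ((le_max_left _ _).trans (le_max_left _ _)).trans hA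
  have hAA₂ : A₂ ≤ A := ((le_max_right _ _).trans (le_max_left _ _)).trans hA
  have hAA₃ : A₃ ≤ A := (le_max_right _ _).trans hA
  have hA0 : 0 < A := by linarith
  have hx0 : 0 < x := by linarith
  -- `p` gives the decay rate but is a subsolution only for `y ≤ 2b(T + 1)`. `w` is one for `y ≥ b(T
  -- + 1)` and is nonpositive for `0 < y ≤ b T`. The ranges overlap, so the maximum with `0` works
  -- everywhere above `A`.
  set p : ℝ → ℝ → ℝ := fun T y => (y ^ γ - A ^ γ) / T ^ γ - M * y / T with hp
  set w : ℝ → ℝ → ℝ := fun T y => 2 * B * (1 - b * T * y⁻¹) with hw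
  set h : ℝ → ℝ → ℝ := fun T y => if A < y then max 0 (max (p T y) (w T y)) else 0 with hh
  have hp_le : ∀ T y, 0 < T → 0 < y → p T y ≤ B := by
    intro T y hT hy
    have h1 := hBr (y / T) (by positivity)
    rw [Real.div_rpow hy.le hT.le] at h1
    have h2 : 0 ≤ A ^ γ / T ^ γ := by positivity
    simp only [hp]
    have : (y ^ γ - A ^ γ) / T ^ γ - M * y / T =
      y ^ γ / T ^ γ - M * (y / T) - A ^ γ / T ^ γ := by ring
    linarith
  have hw_le : ∀ T y, 0 < T → 0 < y → w T y ≤ 2 * B := by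
    intro T y hT hy
    have : 0 ≤ b * T * y⁻¹ := by positivity
    simp only [hw]
    nlinarith
  have hp_h : ∀ T, 0 < T → ∀ y, 0 < y → p T y ≤ h T y := by
    intro T hT y hy
    simp only [hh]
    split_ifs with hAy
    · exact (le_max_left _ _).trans (le_max_right _ _)
    · have h1 : y ^ γ ≤ A ^ γ := Real.rpow_le_rpow hy.le (not_lt.1 hAy) hγ0.le
      have h2 : (y ^ γ - A ^ γ) / T ^ γ ≤ 0 :=
        div_nonpos_of_nonpos_of_nonneg (by linarith) (by positivity)
      have h3 : 0 ≤ M * y / T := by positivity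
      simp only [hp]
      linarith
  have hw_h : ∀ T, 0 < T → A ≤ b * T → ∀ y, 0 < y → w T y ≤ h T y := by
    intro T hT hAT y hy
    simp only [hh]
    split_ifs with hAy
    · exact (le_max_right _ _).trans (le_max_right _ _)
    · have h1 : 1 ≤ b * T * y⁻¹ := by
        rw [← div_eq_mul_inv, one_le_div hy]
        exact (not_lt.1 hAy).trans hAT
      simp only [hw]
      nlinarith
  have hh_nonneg : ∀ T y, 0 ≤ h T y := by
    intro T y
    simp only [hh]
    split_ifs
    · exact le_max_left _ _
    · exact le_rfl
  have hp_step : ∀ T y z, 1 ≤ T → A < y → 0 < z → y ≤ 2 * b * (T + 1) →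
      p (T + 1) y ≤ stepMean K (p T) y z := by
    intro T y z hT hy hz hyT
    have hy0 : 0 < y := by linarith
    have hT0 : 0 < T := by linarith
    have e1 : stepMean K (p T) y z =
        (stepMean K (fun t => t ^ γ) y z - A ^ γ) / T ^ γ - M * stepMean K (fun t => t) y z / T := by
      simp only [stepMean, hp]; ring
    rw [e1, (hinv y z (by linarith) hz).2]
    have h3 := (abs_le.1 (hpow y z (by linarith) hz)).1
    have h4 : y ^ γ + c * y ^ (γ - 1) ≤ stepMean K (fun t => t ^ γ) y z := by
      have : (γ * (1 - (1 - γ) * K ^ 2 / 4) - c) * y ^ (γ - 1) = c * y ^ (γ - 1) := by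
        rw [hdrift]
      linarith
    have h5 : A ^ γ ≤ y ^ γ := Real.rpow_le_rpow hA0.le hy.le hγ0.le
    have h6 : (y ^ γ + c * y ^ (γ - 1) - A ^ γ) / (T + 1) ^ γ ≤
        (stepMean K (fun t => t ^ γ) y z - A ^ γ) / T ^ γ := by
      have : 0 ≤ c * y ^ (γ - 1) := by positivity
      have h7 : T ^ γ ≤ (T + 1) ^ γ := Real.rpow_le_rpow hT0.le (by linarith) hγ0.le
      exact div_le_div₀ (by linarith) (by linarith) (by positivity) h7
    have h7 : M * (y + 1) / T - M * y / (T + 1) ≤ c * y ^ (γ - 1) / (T + 1) ^ γ := by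
      have hr : y / (T + 1) ≤ 2 * b := by rw [div_le_iff₀ (by positivity)]; exact hyT
      have h8 : (2 * b) ^ (γ - 1) ≤ (y / (T + 1)) ^ (γ - 1) :=
        Real.rpow_le_rpow_of_nonpos (by positivity) hr (by linarith)
      have h9 : 2 * M * (y / (T + 1) + 1) ≤ c * (y / (T + 1)) ^ (γ - 1) := by
        calc 2 * M * (y / (T + 1) + 1) ≤ 2 * M * (2 * b + 1) := by gcongr
          _ = c * (2 * b) ^ (γ - 1) := hcM.symm
          _ ≤ _ := by gcongr
      have e2 : c * y ^ (γ - 1) / (T + 1) ^ γ = c * (y / (T + 1)) ^ (γ - 1) / (T + 1) := by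
        rw [Real.div_rpow hy0.le (by positivity), Real.rpow_sub (by positivity : 0 < T + 1),
          Real.rpow_one]
        field_simp
      rw [e2, le_div_iff₀ (by positivity)]
      refine le_trans ?_ h9
      have e3 : (M * (y + 1) / T - M * y / (T + 1)) * (T + 1) =
          M * (y / (T + 1) + 1) * ((T + 1) / T) := by
        field_simp; ring
      have h10 : (T + 1) / T ≤ 2 := by rw [div_le_iff₀ hT0]; linarith
      rw [e3]
      have : 0 ≤ M * (y / (T + 1) + 1) := by positivity
      nlinarith
    simp only [hp]
    have e4 : (y ^ γ + c * y ^ (γ - 1) - A ^ γ) / (T + 1) ^ γ =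
      (y ^ γ - A ^ γ) / (T + 1) ^ γ + c * y ^ (γ - 1) / (T + 1) ^ γ := by ring
    linarith
  have hw_step : ∀ T y z, 0 < T → A < y → 0 < z → b * (T + 1) ≤ y →
      w (T + 1) y ≤ stepMean K (w T) y z := by
    intro T y z hT hy hz hyT
    have hy0 : 0 < y := by linarith
    have e1 : stepMean K (w T) y z = 2 * B * (1 - b * T * stepMean K (fun t => t⁻¹) y z) := by
      simp only [stepMean, hw]; ring
    have h1 := (hinv y z (by linarith) hz).1
    have h2 : b * T * stepMean K (fun t => t⁻¹) y z ≤ b * (T + 1) * y⁻¹ := by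
      calc b * T * stepMean K (fun t => t⁻¹) y z ≤ b * T * (y⁻¹ + b * (y⁻¹) ^ 2) := by gcongr
        _ = b * (T + T * b * y⁻¹) * y⁻¹ := by ring
        _ ≤ b * (T + 1) * y⁻¹ := by
          have : T * b * y⁻¹ ≤ 1 := by
            rw [← div_eq_mul_inv, div_le_one hy0]; nlinarith
          gcongr
    rw [e1]
    simp only [hw]
    gcongr
  have hh_step : ∀ T y z, 1 ≤ T → A ≤ b * T → A < y → 0 < z →
      h (T + 1) y ≤ stepMean K (h T) y z := by
    intro T y z hT hAT hy hz
    have hy0 : 0 < y := by linarith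
    have hT0 : 0 < T := by linarith
    have g0 : 0 ≤ stepMean K (h T) y z := by
      have := hh_nonneg T
      simp only [stepMean]
      linarith [this (growthStep K y z 1 0), this (growthStep K y z (-1) 0),
        this (growthStep K y z 1 1), this (growthStep K y z (-1) 1)]
    have g2 : b * (T + 1) ≤ y → w (T + 1) y ≤ stepMean K (h T) y z := fun hyT =>
      (hw_step T y z hT0 hy hz hyT).trans (hmono y z (by linarith) hz _ _ (hw_h T hT0 hAT))
    have g2' : w (T + 1) y ≤ stepMean K (h T) y z := by
      rcases le_or_gt (b * (T + 1)) y with hyT | hyT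
      · exact g2 hyT
      · refine le_trans ?_ g0
        have h1 : 1 ≤ b * (T + 1) * y⁻¹ := by
          rw [← div_eq_mul_inv, one_le_div hy0]
          exact hyT.le
        simp only [hw]
        nlinarith
    -- Beyond the range of `p`, the linear penalty gives `p ≤ B`, while `w ≥ B` there; the factor
    -- `2` in `w` serves this purpose.
    have g1 : p (T + 1) y ≤ stepMean K (h T) y z := by
      rcases le_or_gt y (2 * b * (T + 1)) with hyT | hyT
      · exact (hp_step T y z hT hy hz hyT).trans (hmono y z (by linarith) hz _ _ (hp_h T hT0))
      · refine le_trans (hp_le _ _ (by linarith) hy0) (le_trans ?_ g2')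
        have h1 : b * (T + 1) * y⁻¹ ≤ 1 / 2 := by
          rw [← div_eq_mul_inv, div_le_iff₀ hy0]
          linarith
        simp only [hw]
        nlinarith
    have : h (T + 1) y = max 0 (max (p (T + 1) y) (w (T + 1) y)) := if_pos hy
    rw [this]
    exact max_le g0 (max_le g1 g2')
  -- Since `γ < 1`, the penalty `M x / T` is negligible against `T ^ (-γ)`. Starting the clock at a
  -- large `S` keeps half of the main term at `x` and ensures `A ≤ b T`.
  have hlim : Tendsto (fun T : ℝ => M * x * T ^ (-(1 - γ))) atTop (𝓝 (M * x * 0)) :=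
    (tendsto_rpow_neg_atTop (by linarith)).const_mul _
  have hgap : 0 < (x ^ γ - A ^ γ) / 2 := by
    have := Real.rpow_lt_rpow hA0.le hx hγ0
    linarith
  rw [mul_zero] at hlim
  obtain ⟨S₁, hS₁⟩ := eventually_atTop.1 (hlim.eventually_le_const hgap)
  obtain ⟨S, hS⟩ := exists_nat_ge (max 1 (max S₁ (A / b)))
  have hS1 : (1 : ℝ) ≤ S := (le_max_left _ _).trans hS
  have hS2 : S₁ ≤ S := ((le_max_left _ _).trans (le_max_right _ _)).trans hS
  have hS3 : A ≤ b * S := by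
    have := ((le_max_right _ _).trans (le_max_right _ _)).trans hS
    rwa [div_le_iff₀' hb0] at this
  have hmS : ∀ m : ℕ, (S : ℝ) ≤ S + m := fun m => by linarith [Nat.cast_nonneg (α := ℝ) m]
  refine ⟨fun m => h (S + m), 2 * B, (x ^ γ - A ^ γ) / 2 / (S + 1) ^ γ, by positivity,
    by positivity, fun m => ?_, fun m y => hh_nonneg _ _, fun m y => ?_, fun m y hy => ?_,
    fun m y z hy hz => ?_, fun m hm => ?_⟩
  · exact Measurable.ite measurableSet_Ioi (by fun_prop) measurable_const
  · simp only [hh]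
    have := hmS m
    split_ifs with hy
    · exact max_le (by positivity) (max_le ((hp_le _ _ (by linarith) (by linarith)).trans
        (by linarith)) (hw_le _ _ (by linarith) (by linarith)))
    · positivity
  · exact if_neg (not_lt.2 hy)
  · have h1 := hmS m
    have := hh_step (S + m) y z (by linarith) (hS3.trans (by gcongr)) hy hz
    push_cast
    rwa [← add_assoc]
  · have h1 := hmS m
    have hm1 : (1 : ℝ) ≤ m := by exact_mod_cast hm
    set T : ℝ := S + m with hT
    have hT0 : 0 < T := by linarith
    refine le_trans ?_ (hp_h T hT0 x hx0)
    have h2 := hS₁ T (by linarith)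
    have e1 : M * x / T = M * x * T ^ (-(1 - γ)) / T ^ γ := by
      rw [mul_div_assoc (M * x), ← Real.rpow_sub hT0, div_eq_mul_inv, ← Real.rpow_neg_one]
      congr 2
      ring
    have h3 : T ^ γ ≤ (S + 1) ^ γ * (m : ℝ) ^ γ := by
      rw [← Real.mul_rpow (by positivity) (by positivity)]
      refine Real.rpow_le_rpow hT0.le ?_ hγ0.le
      rw [hT]
      nlinarith
    simp only [hp]
    rw [e1, ← sub_div, div_div]
    exact div_le_div₀ (by linarith) (by linarith) (by positivity) h3

/-! ### Survival events and the information carried by the past -/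

section Trajectory

variable {Ω : Type*} {K x A : ℝ} {ε : ℕ → Ω → ℝ} {N : (n : ℕ) → Ω → Fin (n + 1)} {U : ℕ → Ω → ℝ}

lemma process_zero (ω : Ω) : process K x ε N U 0 ω = x := by
  simp [process, path]

lemma process_succ (n : ℕ) (ω : Ω) : process K x ε N U (n + 1) ω =
    if process K x ε N U n ω ≤ 0 then 0 else
      growthStep K (process K x ε N U n ω) (process K x ε N U (N n ω) ω) (ε n ω) (U n ω) := by
  unfold process growthStep
  rw [path]

/-- The event that the process stays above `A` up to time `n`. -/
def survival (K x A : ℝ) (ε : ℕ → Ω → ℝ) (N : (n : ℕ) → Ω → Fin (n + 1)) (U : ℕ → Ω → ℝ)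
    (n : ℕ) : Set Ω :=
  {ω | ∀ i ≤ n, A < process K x ε N U i ω}

lemma setOf_lt_tau (n : ℕ) :
    {ω | (n : WithTop ℕ) < tau (process K x ε N U) A ω} = survival K x A ε N U n := by
  ext ω
  simp only [Set.mem_ofPred_eq, survival, tau]
  rw [← not_le, ← not_lt, not_lt]
  constructor
  · intro h i hi
    by_contra hA
    have hmem : process K x ε N U i ω ∈ Set.Iic A := not_lt.1 hA
    exact h ((hittingAfter_le_of_mem (Nat.zero_le i) hmem).trans (WithTop.coe_le_coe.2 hi))
  · intro h hle
    obtain ⟨i, hi, hmem⟩ := (hittingAfter_le_iff).1 hle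
    exact absurd (h i hi.2) (not_lt.2 hmem)

lemma survival_succ_subset (n : ℕ) :
    survival K x A ε N U (n + 1) ⊆ survival K x A ε N U n :=
  fun _ hω i hi => hω i (hi.trans n.le_succ)

lemma survival_zero (hx : A < x) : survival K x A ε N U 0 = Set.univ := by
  ext ω
  simp [survival, process_zero, hx]

lemma measurable_mix {m : MeasurableSpace Ω} {u y z : Ω → ℝ} (hu : Measurable u)
    (hy : Measurable y) (hz : Measurable z) : Measurable fun ω => mix (u ω) (y ω) (z ω) := by
  unfold mix
  fun_prop

lemma measurable_growthStep {m : MeasurableSpace Ω} {y z a b : Ω → ℝ} (hy : Measurable y)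
    (hz : Measurable z) (ha : Measurable a) (hb : Measurable b) :
    Measurable fun ω => growthStep K (y ω) (z ω) (a ω) (b ω) := by
  unfold growthStep
  have := measurable_mix hb hy hz
  fun_prop

lemma measurable_apply_fin {m : MeasurableSpace Ω} {k : ℕ} {X : ℕ → Ω → ℝ}
    {I : Ω → Fin (k + 1)} (hI : Measurable I) (hX : ∀ i ≤ k, Measurable (X i)) :
    Measurable fun ω => X (I ω) ω := by
  have : (fun ω => X (I ω) ω) = fun ω => ∑ j : Fin (k + 1), if I ω = j then X j ω else 0 := by
    ext ω
    simp
  rw [this]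
  refine Finset.measurable_sum _ fun j _ => Measurable.ite ?_ (hX j (by omega)) measurable_const
  exact hI (measurableSet_singleton j)

lemma measurable_process_of_le {m : MeasurableSpace Ω} {k : ℕ}
    (hε : ∀ j < k, Measurable (ε j)) (hN : ∀ j < k, Measurable (N j))
    (hU : ∀ j < k, Measurable (U j)) :
    ∀ i ≤ k, Measurable (process K x ε N U i) := by
  intro i
  induction i using Nat.strong_induction_on with
  | _ i ih =>
    intro hi
    rcases i with _ | i
    · rw [show process K x ε N U 0 = fun _ => x from funext process_zero]
      exact measurable_const
    · have h1 := ih i (Nat.lt_succ_self i) (by omega)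
      rw [show process K x ε N U (i + 1) = _ from funext (process_succ i)]
      refine Measurable.ite (h1 measurableSet_Iic) measurable_const ?_
      exact measurable_growthStep h1
        (measurable_apply_fin (hN i hi) fun j hj => ih j (by omega) (by omega)) (hε i hi) (hU i hi)

lemma measurableSet_survival {m : MeasurableSpace Ω} {k : ℕ}
    (h : ∀ i ≤ k, Measurable (process K x ε N U i)) :
    MeasurableSet (survival K x A ε N U k) := by
  have : survival K x A ε N U k = ⋂ i ∈ Set.Iic k, {ω | A < process K x ε N U i ω} := by
    ext ω; simp [survival]
  rw [this]
  exact MeasurableSet.biInter (Set.to_countable _) fun i hi => h i hi measurableSet_Ioi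

/-- The driving variables as a single family. -/
def noise (ε : ℕ → Ω → ℝ) (N : (n : ℕ) → Ω → Fin (n + 1)) (U : ℕ → Ω → ℝ) :
    ℕ ⊕ (ℕ ⊕ ℕ) → Ω → ℝ :=
  Sum.elim ε (Sum.elim (fun n ω => (((N n ω : Fin (n + 1)) : ℕ) : ℝ)) U)

/-- The indices of the driving variables that determine the first `k` steps and the past time
used in the next one. -/
def pastIndex (k : ℕ) : Set (ℕ ⊕ (ℕ ⊕ ℕ)) :=
  {i | Sum.elim (fun j => j < k) (Sum.elim (fun j => j ≤ k) (fun j => j < k)) i}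

/-- The indices of the sign and the bit used in step `k + 1`. -/
def nextIndex (k : ℕ) : Set (ℕ ⊕ (ℕ ⊕ ℕ)) := {Sum.inl k, Sum.inr (Sum.inr k)}

/-- The σ-algebra generated by the driving variables with index in `S`. -/
abbrev noiseSigma (ε : ℕ → Ω → ℝ) (N : (n : ℕ) → Ω → Fin (n + 1)) (U : ℕ → Ω → ℝ)
    (S : Set (ℕ ⊕ (ℕ ⊕ ℕ))) : MeasurableSpace Ω :=
  ⨆ i ∈ S, (inferInstance : MeasurableSpace ℝ).comap (noise ε N U i)

lemma measurable_noise_noiseSigma {S : Set (ℕ ⊕ (ℕ ⊕ ℕ))} {i : ℕ ⊕ (ℕ ⊕ ℕ)} (hi : i ∈ S) :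
    Measurable[noiseSigma ε N U S] (noise ε N U i) := by
  rw [measurable_iff_comap_le]
  exact le_iSup₂_of_le i hi le_rfl

lemma measurable_time_past {k j : ℕ} (hj : j ≤ k) :
    Measurable[noiseSigma ε N U (pastIndex k)] (N j) := by
  refine @measurable_to_countable' _ _ _ _ (noiseSigma ε N U (pastIndex k)) _ fun i => ?_
  have h1 : Measurable[noiseSigma ε N U (pastIndex k)] (noise ε N U (Sum.inr (Sum.inl j))) :=
    measurable_noise_noiseSigma hj
  have h2 := h1 (measurableSet_singleton ((i : ℕ) : ℝ))
  convert h2 using 1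
  ext ω
  simp [noise, Fin.ext_iff]

lemma measurable_process_past {k i : ℕ} (hi : i ≤ k) :
    Measurable[noiseSigma ε N U (pastIndex k)] (process K x ε N U i) :=
  @measurable_process_of_le _ K x ε N U (noiseSigma ε N U (pastIndex k)) k
    (fun j hj => measurable_noise_noiseSigma (i := Sum.inl j) hj)
    (fun _ hj => measurable_time_past hj.le)
    (fun j hj => measurable_noise_noiseSigma (i := Sum.inr (Sum.inr j)) hj) i hi

/-- The event that step `k + 1` uses the sign `a` and the bit `b`. -/
def stepEvent (ε U : ℕ → Ω → ℝ) (k : ℕ) (a b : ℝ) : Set Ω := {ω | ε k ω = a} ∩ {ω | U k ω = b}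

lemma measurableSet_stepEvent (k : ℕ) (a b : ℝ) :
    MeasurableSet[noiseSigma ε N U (nextIndex k)] (stepEvent ε U k a b) := by
  have h1 : Measurable[noiseSigma ε N U (nextIndex k)] (noise ε N U (Sum.inl k)) :=
    measurable_noise_noiseSigma (by simp [nextIndex])
  have h2 : Measurable[noiseSigma ε N U (nextIndex k)] (noise ε N U (Sum.inr (Sum.inr k))) :=
    measurable_noise_noiseSigma (by simp [nextIndex])
  exact MeasurableSet.inter (h1 (measurableSet_singleton a)) (h2 (measurableSet_singleton b))

lemma measurable_growthStep_past (k : ℕ) (a b : ℝ) :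
    Measurable[noiseSigma ε N U (pastIndex k)] fun ω => growthStep K (process K x ε N U k ω)
      (process K x ε N U (N k ω) ω) a b :=
  @measurable_growthStep _ K (noiseSigma ε N U (pastIndex k)) _ _ _ _
    (measurable_process_past le_rfl)
    (@measurable_apply_fin _ (noiseSigma ε N U (pastIndex k)) _ _ _ (measurable_time_past le_rfl)
      fun _ hi => measurable_process_past hi)
    (@measurable_const _ _ _ (noiseSigma ε N U (pastIndex k)) a)
    (@measurable_const _ _ _ (noiseSigma ε N U (pastIndex k)) b)

end Trajectory

/-! ### Independence, one-step expectations and their iteration -/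

section Noise

variable {Ω : Type*} [MeasurableSpace Ω] {μ : Measure Ω}
  {K x A : ℝ} {ε : ℕ → Ω → ℝ} {N : (n : ℕ) → Ω → Fin (n + 1)} {U : ℕ → Ω → ℝ}

lemma IsNoise.measurable_noise (h : IsNoise μ ε N U) (i : ℕ ⊕ (ℕ ⊕ ℕ)) :
    Measurable (noise ε N U i) := by
  rcases i with j | j | j
  · exact h.measurable_sign j
  · exact (measurable_from_top (f := fun i : Fin (j + 1) => ((i : ℕ) : ℝ))).comp
      (h.measurable_time j)
  · exact h.measurable_bit j

lemma IsNoise.noiseSigma_le (h : IsNoise μ ε N U) (S : Set (ℕ ⊕ (ℕ ⊕ ℕ))) :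
    noiseSigma ε N U S ≤ (inferInstance : MeasurableSpace Ω) :=
  iSup₂_le fun i _ => (h.measurable_noise i).comap_le

/-- The past includes the time `N k` itself, so the past state used in the next step is frozen and
only sign and bit are averaged. -/
lemma IsNoise.indep_next_past (h : IsNoise μ ε N U) (k : ℕ) :
    Indep (noiseSigma ε N U (nextIndex k)) (noiseSigma ε N U (pastIndex k)) μ := by
  refine indep_iSup_of_disjoint (fun i => (h.measurable_noise i).comap_le) h.indep ?_
  rw [Set.disjoint_left]
  rintro i (rfl | rfl) hi <;> simp [pastIndex] at hi

lemma IsNoise.measurable_process (h : IsNoise μ ε N U) (i : ℕ) :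
    Measurable (process K x ε N U i) :=
  (measurable_process_past le_rfl).mono (h.noiseSigma_le _) le_rfl

lemma IsNoise.measureReal_stepEvent (h : IsNoise μ ε N U) (k : ℕ) {a b : ℝ}
    (ha : μ.real {ω | ε k ω = a} = 1 / 2) (hb : μ.real {ω | U k ω = b} = 1 / 2) :
    μ.real (stepEvent ε U k a b) = 1 / 4 := by
  have h1 : IndepFun (ε k) (U k) μ :=
    h.indep.indepFun (i := Sum.inl k) (j := Sum.inr (Sum.inr k)) (by simp)
  have h2 := h1.measure_inter_preimage_eq_mul {a} {b} (measurableSet_singleton a)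
    (measurableSet_singleton b)
  have h3 : μ.real (stepEvent ε U k a b) = μ.real {ω | ε k ω = a} * μ.real {ω | U k ω = b} := by
    simp only [measureReal_def, ← ENNReal.toReal_mul]
    exact congrArg _ h2
  rw [h3, ha, hb]; norm_num

lemma integral_add_four {ν : Measure Ω} {f g h i : Ω → ℝ} (hf : Integrable f ν)
    (hg : Integrable g ν) (hh : Integrable h ν) (hi : Integrable i ν) :
    ∫ ω, (f ω + g ω + h ω + i ω) ∂ν =
      ∫ ω, f ω ∂ν + ∫ ω, g ω ∂ν + ∫ ω, h ω ∂ν + ∫ ω, i ω ∂ν := by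
  rw [integral_add (f := fun ω => f ω + g ω + h ω) ((hf.add hg).add hh) hi,
    integral_add (f := fun ω => f ω + g ω) (hf.add hg) hh, integral_add hf hg]

lemma IsNoise.measurableSet_survival (h : IsNoise μ ε N U) (k : ℕ) :
    MeasurableSet (survival K x A ε N U k) :=
  GrowthExample.measurableSet_survival fun _ _ => h.measurable_process _

lemma IsNoise.measurable_past_value (h : IsNoise μ ε N U) (k : ℕ) :
    Measurable fun ω => process K x ε N U (N k ω) ω :=
  measurable_apply_fin (h.measurable_time k) fun _ _ => h.measurable_process _

variable [IsProbabilityMeasure μ]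

lemma ae_eq_or_eq {f : Ω → ℝ} (hf : Measurable f) {a b : ℝ} (hab : a ≠ b)
    (ha : μ.real {ω | f ω = a} = 1 / 2) (hb : μ.real {ω | f ω = b} = 1 / 2) :
    ∀ᵐ ω ∂μ, f ω = a ∨ f ω = b := by
  have hma : MeasurableSet {ω | f ω = a} := hf (measurableSet_singleton a)
  have hmb : MeasurableSet {ω | f ω = b} := hf (measurableSet_singleton b)
  have hdisj : Disjoint {ω | f ω = a} {ω | f ω = b} := by
    rw [Set.disjoint_left]
    intro ω h1 h2
    exact hab (h1.symm.trans h2)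
  have h : μ.real ({ω | f ω = a} ∪ {ω | f ω = b}) = 1 := by
    rw [measureReal_union hdisj hmb, ha, hb]; norm_num
  have h' : μ.real ({ω | f ω = a} ∪ {ω | f ω = b})ᶜ = 0 := by
    rw [probReal_compl_eq_one_sub (hma.union hmb), h, sub_self]
  exact (measureReal_eq_zero_iff).1 h'

lemma integrable_of_measurable_of_le {f : Ω → ℝ} (hf : Measurable f) {H : ℝ}
    (h0 : ∀ ω, 0 ≤ f ω) (h1 : ∀ ω, f ω ≤ H) : Integrable f μ :=
  Integrable.of_bound hf.aestronglyMeasurable H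
    (ae_of_all _ fun ω => by rw [Real.norm_eq_abs, abs_of_nonneg (h0 ω)]; exact h1 ω)

/-- The one-step conditional expectation, integrated over the event of survival. -/
lemma IsNoise.setIntegral_process_succ (h : IsNoise μ ε N U) (hA : 0 ≤ A) {f : ℝ → ℝ} {H : ℝ}
    (hf : Measurable f) (hf0 : ∀ y, 0 ≤ f y) (hfH : ∀ y, f y ≤ H) (k : ℕ) :
    ∫ ω in survival K x A ε N U k, f (process K x ε N U (k + 1) ω) ∂μ =
      ∫ ω in survival K x A ε N U k,
        stepMean K f (process K x ε N U k ω) (process K x ε N U (N k ω) ω) ∂μ := by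
  set G := survival K x A ε N U k with hG
  have hGp : MeasurableSet[noiseSigma ε N U (pastIndex k)] G :=
    @GrowthExample.measurableSet_survival _ K x A ε N U (noiseSigma ε N U (pastIndex k)) k
      fun _ hi => measurable_process_past hi
  have hGm : MeasurableSet G := h.noiseSigma_le _ _ hGp
  set Y : ℝ → ℝ → Ω → ℝ := fun a b ω => f (growthStep K (process K x ε N U k ω)
    (process K x ε N U (N k ω) ω) a b) with hY
  have hYp : ∀ a b, Measurable[noiseSigma ε N U (pastIndex k)] (Y a b) := fun a b =>
    hf.comp (measurable_growthStep_past k a b)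
  have hYi : ∀ a b, Integrable (Y a b) μ := fun a b =>
    integrable_of_measurable_of_le ((hYp a b).mono (h.noiseSigma_le _) le_rfl)
      (fun _ => hf0 _) (fun _ => hfH _)
  have hE : ∀ a b, MeasurableSet (stepEvent ε U k a b) := fun a b =>
    h.noiseSigma_le _ _ (measurableSet_stepEvent (N := N) k a b)
  have key : ∀ a b, μ.real {ω | ε k ω = a} = 1 / 2 → μ.real {ω | U k ω = b} = 1 / 2 →
      ∫ ω, (stepEvent ε U k a b).indicator (G.indicator (Y a b)) ω ∂μ =
        1 / 4 * ∫ ω in G, Y a b ω ∂μ := by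
    intro a b ha hb
    have hZp : Measurable[noiseSigma ε N U (pastIndex k)] (G.indicator (Y a b)) :=
      (hYp a b).indicator hGp
    have hind : Indep (noiseSigma ε N U (nextIndex k))
        ((inferInstance : MeasurableSpace ℝ).comap (G.indicator (Y a b))) μ :=
      indep_of_indep_of_le_right (h.indep_next_past k) hZp.comap_le
    have := hind.setIntegral_eq_mul (f := id) (h.noiseSigma_le _)
      (hZp.mono (h.noiseSigma_le _) le_rfl).aemeasurable (measurableSet_stepEvent k a b)
      measurable_id.aestronglyMeasurable
    rw [integral_indicator (hE a b), ← integral_indicator hGm, ← h.measureReal_stepEvent k ha hb]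
    exact this
  have hint : ∀ a b, Integrable ((stepEvent ε U k a b).indicator (G.indicator (Y a b))) μ :=
    fun a b => ((hYi a b).indicator hGm).indicator (hE a b)
  -- On survival, sign and bit almost surely take one of four pairs of values. Given the pair, the
  -- next state is a function of the past.
  have hae : G.indicator (fun ω => f (process K x ε N U (k + 1) ω)) =ᵐ[μ] fun ω =>
      (stepEvent ε U k 1 0).indicator (G.indicator (Y 1 0)) ω +
      (stepEvent ε U k (-1) 0).indicator (G.indicator (Y (-1) 0)) ω +
      (stepEvent ε U k 1 1).indicator (G.indicator (Y 1 1)) ω +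
      (stepEvent ε U k (-1) 1).indicator (G.indicator (Y (-1) 1)) ω := by
    filter_upwards [ae_eq_or_eq (h.measurable_sign k) (by norm_num) (h.sign_neg k) (h.sign_pos k),
      ae_eq_or_eq (h.measurable_bit k) (by norm_num) (h.bit_zero k) (h.bit_one k)] with ω h1 h2
    by_cases hω : ω ∈ G
    · have hpos : ¬ process K x ε N U k ω ≤ 0 := not_le.2 (hA.trans_lt (hω k le_rfl))
      have hs : process K x ε N U (k + 1) ω = growthStep K (process K x ε N U k ω)
          (process K x ε N U (N k ω) ω) (ε k ω) (U k ω) := by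
        rw [process_succ, if_neg hpos]
      have n1 : (-1 : ℝ) ≠ 1 := by norm_num
      have n2 : (1 : ℝ) ≠ -1 := by norm_num
      rw [Set.indicator_of_mem hω, hs]
      rcases h1 with h1 | h1 <;> rcases h2 with h2 | h2 <;>
        simp [Set.indicator, stepEvent, h1, h2, hω, hY, n1, n2]
    · simp [Set.indicator, hω]
  have e4 : ∀ ω, stepMean K f (process K x ε N U k ω) (process K x ε N U (N k ω) ω) =
      1 / 4 * Y 1 0 ω + 1 / 4 * Y (-1) 0 ω + 1 / 4 * Y 1 1 ω + 1 / 4 * Y (-1) 1 ω := by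
    intro ω
    simp only [stepMean, hY]; ring
  have hq : ∀ a b, Integrable (fun ω => 1 / 4 * Y a b ω) (μ.restrict G) := fun a b =>
    ((hYi a b).const_mul _).integrableOn
  rw [← integral_indicator hGm, integral_congr_ae hae]
  simp only [e4]
  rw [integral_add_four (hint _ _) (hint _ _) (hint _ _) (hint _ _),
    integral_add_four (hq _ _) (hq _ _) (hq _ _) (hq _ _),
    key _ _ (h.sign_pos k) (h.bit_zero k), key _ _ (h.sign_neg k) (h.bit_zero k),
    key _ _ (h.sign_pos k) (h.bit_one k), key _ _ (h.sign_neg k) (h.bit_one k)]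
  simp only [integral_const_mul]

lemma IsNoise.integrable_comp_process (h : IsNoise μ ε N U) {f : ℝ → ℝ} {H : ℝ}
    (hf : Measurable f) (hf0 : ∀ y, 0 ≤ f y) (hfH : ∀ y, f y ≤ H) (k : ℕ) :
    Integrable (fun ω => f (process K x ε N U k ω)) μ :=
  integrable_of_measurable_of_le (hf.comp (h.measurable_process k)) (fun _ => hf0 _) fun _ => hfH _

lemma IsNoise.integrable_stepMean (h : IsNoise μ ε N U) {f : ℝ → ℝ} {H : ℝ}
    (hf : Measurable f) (hf0 : ∀ y, 0 ≤ f y) (hfH : ∀ y, f y ≤ H) (k : ℕ) :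
    Integrable (fun ω => stepMean K f (process K x ε N U k ω)
      (process K x ε N U (N k ω) ω)) μ := by
  have hY : ∀ a b, Integrable (fun ω => f (growthStep K (process K x ε N U k ω)
      (process K x ε N U (N k ω) ω) a b)) μ := fun a b =>
    integrable_of_measurable_of_le (hf.comp (measurable_growthStep (h.measurable_process k)
      (h.measurable_past_value k) measurable_const measurable_const)) (fun _ => hf0 _)
      fun _ => hfH _
  exact ((((hY 1 0).add (hY (-1) 0)).add (hY 1 1)).add (hY (-1) 1)).div_const 4

/-- Each backward step trades one unit of elapsed time for one of remaining time. Enlarging the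
survival event by one step only increases the integral, because `v` is nonnegative. -/
lemma IsNoise.measureReal_survival_le (h : IsNoise μ ε N U) (hA : 0 ≤ A) (hx : A < x)
    {v : ℕ → ℝ → ℝ} {H : ℝ} (hv : ∀ m, Measurable (v m)) (hv0 : ∀ m y, 0 ≤ v m y)
    (hvH : ∀ m y, v m y ≤ H)
    (hstep : ∀ m y z, A < y → 0 < z → stepMean K (v m) y z ≤ v (m + 1) y)
    (hend : ∀ y, A < y → v 0 y = 1) (n : ℕ) :
    μ.real (survival K x A ε N U n) ≤ v n x := by
  have key : ∀ k m, ∫ ω in survival K x A ε N U k, v m (process K x ε N U k ω) ∂μ ≤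
      v (m + k) x := by
    intro k
    induction k with
    | zero =>
      intro m
      rw [survival_zero hx]
      simp [process_zero]
    | succ k ih =>
      intro m
      calc ∫ ω in survival K x A ε N U (k + 1), v m (process K x ε N U (k + 1) ω) ∂μ
          ≤ ∫ ω in survival K x A ε N U k, v m (process K x ε N U (k + 1) ω) ∂μ :=
            setIntegral_mono_set (h.integrable_comp_process (hv m) (hv0 m) (hvH m) _).integrableOn
              (ae_of_all _ fun _ => hv0 _ _) (survival_succ_subset k).eventuallyLE
        _ = _ := h.setIntegral_process_succ hA (hv m) (hv0 m) (hvH m) k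
        _ ≤ ∫ ω in survival K x A ε N U k, v (m + 1) (process K x ε N U k ω) ∂μ := by
            refine setIntegral_mono_on
              (h.integrable_stepMean (hv m) (hv0 m) (hvH m) k).integrableOn
              (h.integrable_comp_process (hv _) (hv0 _) (hvH _) _).integrableOn
              (h.measurableSet_survival k) fun ω hω => ?_
            exact hstep m _ _ (hω k le_rfl)
              (hA.trans_lt (hω _ (Nat.lt_succ_iff.1 (N k ω).is_lt)))
        _ ≤ v (m + 1 + k) x := ih (m + 1)
        _ = v (m + (k + 1)) x := by rw [add_assoc, add_comm 1 k]
  have h0 := key n 0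
  rw [zero_add, setIntegral_congr_fun (g := fun _ => (1 : ℝ)) (h.measurableSet_survival n)
    (fun ω hω => hend _ (hω n le_rfl))] at h0
  simpa using h0

/-- The same iteration reversed. Paths falling to `A` or below contribute nothing since `v` vanishes
there, so shrinking the survival event costs nothing; the bound `H` then extracts the probability.
-/
lemma IsNoise.le_measureReal_survival (h : IsNoise μ ε N U) (hA : 0 ≤ A) (hx : A < x)
    {v : ℕ → ℝ → ℝ} {H : ℝ} (hv : ∀ m, Measurable (v m)) (hv0 : ∀ m y, 0 ≤ v m y)
    (hvH : ∀ m y, v m y ≤ H) (hvA : ∀ m y, y ≤ A → v m y = 0)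
    (hstep : ∀ m y z, A < y → 0 < z → v (m + 1) y ≤ stepMean K (v m) y z) (n : ℕ) :
    v n x ≤ H * μ.real (survival K x A ε N U n) := by
  have key : ∀ k m, v (m + k) x ≤
      ∫ ω in survival K x A ε N U k, v m (process K x ε N U k ω) ∂μ := by
    intro k
    induction k with
    | zero =>
      intro m
      rw [survival_zero hx]
      simp [process_zero]
    | succ k ih =>
      intro m
      calc v (m + (k + 1)) x = v (m + 1 + k) x := by rw [add_assoc, add_comm 1 k]
        _ ≤ ∫ ω in survival K x A ε N U k, v (m + 1) (process K x ε N U k ω) ∂μ := ih (m + 1)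
        _ ≤ ∫ ω in survival K x A ε N U k,
              stepMean K (v m) (process K x ε N U k ω) (process K x ε N U (N k ω) ω) ∂μ := by
            refine setIntegral_mono_on
              (h.integrable_comp_process (hv _) (hv0 _) (hvH _) _).integrableOn
              (h.integrable_stepMean (hv m) (hv0 m) (hvH m) k).integrableOn
              (h.measurableSet_survival k) fun ω hω => ?_
            exact hstep m _ _ (hω k le_rfl)
              (hA.trans_lt (hω _ (Nat.lt_succ_iff.1 (N k ω).is_lt)))
        _ = ∫ ω in survival K x A ε N U k, v m (process K x ε N U (k + 1) ω) ∂μ :=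
            (h.setIntegral_process_succ hA (hv m) (hv0 m) (hvH m) k).symm
        _ = _ := by
            rw [← integral_indicator (h.measurableSet_survival k),
              ← integral_indicator (h.measurableSet_survival (k + 1))]
            congr 1
            ext ω
            by_cases hω : ω ∈ survival K x A ε N U k
            · rw [Set.indicator_of_mem hω]
              by_cases hω' : ω ∈ survival K x A ε N U (k + 1)
              · rw [Set.indicator_of_mem hω']
              · rw [Set.indicator_of_notMem hω']
                refine hvA _ _ (not_lt.1 fun hlt => hω' fun i hi => ?_)
                rcases Nat.le_succ_iff.1 hi with hi | rfl
                · exact hω i hi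
                · exact hlt
            · rw [Set.indicator_of_notMem hω,
                Set.indicator_of_notMem fun hω' => hω (survival_succ_subset k hω')]
  have h0 := key n 0
  rw [zero_add] at h0
  refine h0.trans ?_
  refine (setIntegral_mono (g := fun _ => H)
    (h.integrable_comp_process (hv 0) (hv0 0) (hvH 0) _).integrableOn
    (integrable_const H).integrableOn fun ω => hvH _ _).trans_eq ?_
  simp [mul_comm]

end Noise

end GrowthExample

theorem mainTheorem6 (K : ℝ) (hK : 2 < K) (α β : ℝ)
    (hα : α < 1 - 4 / K ^ 2) (hβ : 1 - 4 / K ^ 2 < β) :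
    ∃ A : ℝ, 0 < A ∧ ∀ x : ℝ, A < x → ∃ Cα Cβ : ℝ, 0 < Cα ∧ 0 < Cβ ∧
      ∀ (Ω : Type*) [MeasurableSpace Ω] (μ : Measure Ω) [IsProbabilityMeasure μ]
        (ε : ℕ → Ω → ℝ) (N : (n : ℕ) → Ω → Fin (n + 1)) (U : ℕ → Ω → ℝ),
        GrowthExample.IsNoise μ ε N U →
        ∀ n : ℕ, 1 ≤ n →
          Cβ / (n : ℝ) ^ β ≤
              μ.real {ω | (n : WithTop ℕ) <
                GrowthExample.tau (GrowthExample.process K x ε N U) A ω} ∧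
            μ.real {ω | (n : WithTop ℕ) <
                GrowthExample.tau (GrowthExample.process K x ε N U) A ω} ≤
              Cα / (n : ℝ) ^ α := by
  have hK0 : 0 < K := by linarith
  have hp0 : 0 < 1 - 4 / K ^ 2 := by
    rw [sub_pos, div_lt_one (by positivity)]
    nlinarith
  have hp1 : 1 - 4 / K ^ 2 < 1 := by
    have : 0 < 4 / K ^ 2 := by positivity
    linarith
  set p := 1 - 4 / K ^ 2 with hp
  -- The barriers need exponents in `(0, 1)`, so `α` is raised and `β` lowered without crossing `p`;
  -- as `n ≥ 1`, this only strengthens both bounds.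
  obtain ⟨A₁, hA₁, hsup⟩ := GrowthExample.exists_supersolution (γ := max α (p / 2)) hK0
    ((half_pos hp0).trans_le (le_max_right _ _)) (max_lt hα (half_lt_self hp0))
  obtain ⟨A₂, hA₂, hsub⟩ := GrowthExample.exists_subsolution (γ := min β ((p + 1) / 2)) hK0
    (hp0.trans (lt_min hβ (by linarith))) ((min_le_right _ _).trans_lt (by linarith))
    (lt_min hβ (by linarith))
  have hA : 0 < max A₁ A₂ := by linarith [le_max_left A₁ A₂]
  refine ⟨max A₁ A₂, hA, fun x hx => ?_⟩
  obtain ⟨v, C, hC, hvm, hv0, hv1, hvstep, hvend, hvx⟩ := hsup _ (le_max_left _ _) x hx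
  obtain ⟨w, H, q, hH, hq, hwm, hw0, hwH, hwA, hwstep, hwx⟩ := hsub _ (le_max_right _ _) x hx
  refine ⟨C, q / H, hC, by positivity, fun Ω _ μ _ ε N U h n hn => ?_⟩
  rw [GrowthExample.setOf_lt_tau]
  have hn1 : (1 : ℝ) ≤ n := by exact_mod_cast hn
  have hn0 : (0 : ℝ) < n := by linarith
  constructor
  · have h1 := h.le_measureReal_survival hA.le hx hwm hw0 hwH hwA hwstep n
    have h2 := (hwx n hn).trans h1
    have h3 : q / (n : ℝ) ^ β ≤ q / (n : ℝ) ^ min β ((p + 1) / 2) := by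
      gcongr
      exact min_le_left _ _
    calc q / H / (n : ℝ) ^ β = q / (n : ℝ) ^ β / H := by ring
      _ ≤ _ := by rw [div_le_iff₀' hH]; exact h3.trans h2
  · refine ((h.measureReal_survival_le hA.le hx hvm hv0 hv1 hvstep hvend n).trans (hvx n hn)).trans ?_
    gcongr
    exact le_max_left _ _
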